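/- Let $(W,S)$ be a finite Coxeter system with length function $\ell$, and let $\mathcal I_W$ be the $\mathbb{Q}$-vector space with basis $\{a_w : w\in W,\ w^2=1\}$. For $k\in\mathbb{Q}$ and $s\in S$ let $\varrho_{W,k}(s)$ be the linear endomorphism of $\mathcal I_W$ given, for $w\in W$ with $w^2=1$, by $$\varrho_{W,k}(s)a_w=\begin{cases} a_w+k\,a_{sw} & \text{if } sw=ws \text{ and } \ell(ws)>\ell(w),\\ -a_w & \text{if } sw=ws\text{ and }\ell(ws)<\ell(w),\\ a_{sws} & \text{if } sw\ne ws.\end{cases}$$ Then: (1) For every $k\in\mathbb{Q}$, the map $\varrho_{W,k}$ on $S$ extends (necessarily uniquely) to a representation of $W$ in $\mathcal I_W$, again denoted $\varrho_{W,k}$. (2) For all $k,k'\in\mathbb{Q}$, the representations $\varrho_{W,k}$ and $\varrho_{W,k'}$ of $W$ are isomorphic. In particular, the map $\varrho_W$ on $S$ defined by $\varrho_W(s)a_w=-a_w$ if $sw=ws$ and $\ell(ws)<\ell(w)$, and $\varrho_W(s)a_w=a_{sws}$ otherwise, equals $\varrho_{W,0}$ and extends uniquely to a representation of $W$ in $\mathcal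 I_W$. -/

import Mathlib

namespace CoxeterInvolution

/-- The elements `w` of a group with `w ^ 2 = 1` (the identity is included). -/
abbrev Invol (W : Type*) [Group W] : Type _ := {w : W // w ^ 2 = 1}

/-- The rational vector space with basis `a_w` indexed by the `w` with `w ^ 2 = 1`. -/
abbrev InvolModule (W : Type*) [Group W] : Type _ := Invol W →₀ ℚ

/-- The basis vector `a_w`. -/
noncomputable def a {W : Type*} [Group W] (w : Invol W) : InvolModule W := Finsupp.single w 1

/-- The element `s w s`, for a simple reflection `s = s_i`, as an element of square one. -/
def conjSimple {B W : Type*} [Group W] {M : CoxeterMatrix B} (cs : CoxeterSystem M W)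
    (i : B) (w : Invol W) : Invol W :=
  ⟨cs.simple i * w.1 * cs.simple i, by
    have h : w.1 * w.1 = 1 := by simpa [pow_two] using w.2
    calc (cs.simple i * w.1 * cs.simple i) ^ 2
        = cs.simple i * w.1 * (cs.simple i * cs.simple i) * w.1 * cs.simple i := by
          simp only [pow_two, mul_assoc]
      _ = cs.simple i * (w.1 * w.1) * cs.simple i := by
          rw [cs.simple_mul_simple_self, mul_one]; simp only [mul_assoc]
      _ = 1 := by rw [h, mul_one, cs.simple_mul_simple_self]⟩

/-- The element `s w`, for a simple reflection `s = s_i` commuting with `w`, as an element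
of square one. -/
def mulSimple {B W : Type*} [Group W] {M : CoxeterMatrix B} (cs : CoxeterSystem M W)
    (i : B) (w : Invol W) (h : cs.simple i * w.1 = w.1 * cs.simple i) : Invol W :=
  ⟨cs.simple i * w.1, by
    have hc : Commute (cs.simple i) w.1 := h
    rw [hc.mul_pow, cs.simple_sq, w.2, one_mul]⟩

open Classical in
/-- The value of the map with parameter `k` at the simple reflection `s = s_i`: the linear
endomorphism sending `a_w` to `a_w + k a_{sw}` if `sw = ws` and `s` is not a right descent of `w`,
to `-a_w` if `sw = ws` and `s` is a right descent of `w`, and to `a_{sws}` if `sw ≠ ws`. -/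
noncomputable def rhoK {B W : Type*} [Group W] {M : CoxeterMatrix B} (cs : CoxeterSystem M W)
    (k : ℚ) (i : B) : InvolModule W →ₗ[ℚ] InvolModule W :=
  Finsupp.linearCombination ℚ fun w : Invol W =>
    if h : cs.simple i * w.1 = w.1 * cs.simple i then
      if cs.IsRightDescent w.1 i then -a w else a w + k • a (mulSimple cs i w h)
    else a (conjSimple cs i w)

open Classical in
/-- The value at the simple reflection `s = s_i` of the map without parameter: the linear
endomorphism sending `a_w` to `-a_w` if `sw = ws` and `ℓ(ws) < ℓ(w)`, and to `a_{sws}`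
otherwise. -/
noncomputable def rho {B W : Type*} [Group W] {M : CoxeterMatrix B} (cs : CoxeterSystem M W)
    (i : B) : InvolModule W →ₗ[ℚ] InvolModule W :=
  Finsupp.linearCombination ℚ fun w : Invol W =>
    if cs.simple i * w.1 = w.1 * cs.simple i ∧ cs.length (w.1 * cs.simple i) < cs.length w.1 then
      -a w
    else a (conjSimple cs i w)

/-- The representation `ρ` of `W` restricts on the simple reflections to the map `f`. -/
def Extends {B W V : Type*} [Group W] [AddCommGroup V] [Module ℚ V] {M : CoxeterMatrix B}
    (cs : CoxeterSystem M W) (f : B → V →ₗ[ℚ] V) (ρ : Representation ℚ W V) : Prop :=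
  ∀ i : B, ρ (cs.simple i) = f i

end CoxeterInvolution

/-! In the geometric representation, s commutes with w exactly when w sends the simple root α of s
to α or -α (`simple_mul_comm_iff`), and among these cases s is a descent of w exactly when wα = -α.
So the three cases of `rhoK` become wα = -α, wα = α, and neither.

For k = 0, W acts on the basis by conjugation up to sign: g sends a_w to ± the basis vector of
gwg⁻¹, the sign being the parity of the number of positive roots negated by w that g makes negative.
This sign is a cocycle (`conjSign_mul`), and for a simple reflection only α can contribute
(`conjSign_simple`), so the result extends `rhoK cs 0`.

For other k no Coxeter relation is checked. Put w ≤ z when w and z commute and the (-1)-eigenspace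
of w lies in that of z, and let r be the dimension of that eigenspace. `intertwiner cs c` sends a_w
to the sum over z ≥ w of c^(r(z) - r(w)) ε(z,w) a_z, with ε = `keptSign`. It is unitriangular for
this order, hence bijective, and carries `rhoK cs 0` to `rhoK cs (2 * c)`. For commuting
involutions, ε changes sign under simultaneous conjugation by s exactly when zα = -α and wα is not
±α (`keptSign_conj`, `keptSign_conj_of_not`), and is unchanged by z ↦ sz when z and w fix α
(`keptSign_simple_mul`). With c = k/2 the representation for k = 0 is transported to every k, which
gives existence and all the isomorphisms; uniqueness holds because W is generated by S. -/

namespace CoxeterInvolution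

/-! ### The geometric representation: form, reflections, Coxeter relations. -/

section GeometricRepresentation

open Real

variable {B : Type*} (M : CoxeterMatrix B)

/-- The symmetric bilinear form attached to a Coxeter matrix. -/
noncomputable def form : (B →₀ ℝ) →ₗ[ℝ] (B →₀ ℝ) →ₗ[ℝ] ℝ :=
  Finsupp.linearCombination ℝ fun i =>
    Finsupp.linearCombination ℝ fun j => -cos (π / M i j)

/-- The simple root indexed by `i`. -/
noncomputable def simpleRoot (i : B) : B →₀ ℝ := Finsupp.single i 1

theorem form_simpleRoot (i j : B) :
    form M (simpleRoot i) (simpleRoot j) = -cos (π / M i j) := by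
  simp [form, simpleRoot]

theorem form_simpleRoot_self (i : B) : form M (simpleRoot i) (simpleRoot i) = 1 := by
  simp [form_simpleRoot]

theorem form_comm (u v : B →₀ ℝ) : form M u v = form M v u := by
  have h : form M = (form M).flip := by
    ext i j
    have := form_simpleRoot M i j
    have h2 := form_simpleRoot M j i
    rw [M.symmetric] at h2
    simp only [simpleRoot] at this h2
    simp [this, h2]
  exact congrArg (fun f => f u v) h

theorem two_smul_form_apply_self (i : B) :
    ((2 : ℝ) • form M (simpleRoot i)) (simpleRoot i) = 2 := by
  simp [form_simpleRoot_self]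

/-- The reflection in the simple root indexed by `i`. -/
noncomputable def simpleReflection (i : B) : (B →₀ ℝ) ≃ₗ[ℝ] (B →₀ ℝ) :=
  Module.reflection (two_smul_form_apply_self M i)

theorem simpleReflection_apply (i : B) (v : B →₀ ℝ) :
    simpleReflection M i v = v - (2 * form M (simpleRoot i) v) • simpleRoot i := by
  simp [simpleReflection, Module.reflection_apply]

theorem simpleReflection_mul_self (i : B) : simpleReflection M i * simpleReflection M i = 1 := by
  ext1 v
  exact Module.involutive_reflection (two_smul_form_apply_self M i) v

theorem form_simpleReflection (i : B) (u v : B →₀ ℝ) :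
    form M (simpleReflection M i u) (simpleReflection M i v) = form M u v := by
  simp only [simpleReflection_apply, map_sub, map_smul, LinearMap.sub_apply, LinearMap.smul_apply,
    form_simpleRoot_self, smul_eq_mul, form_comm M u (simpleRoot i)]
  ring

theorem simpleReflection_mul_pow (i j : B) :
    (simpleReflection M i * simpleReflection M j) ^ M i j = 1 := by
  by_cases hij : i = j
  · subst hij
    rw [simpleReflection_mul_self, one_pow]
  rcases Nat.eq_zero_or_pos (M i j) with h0 | h0
  · rw [h0, pow_zero]
  have h1 : M i j ≠ 1 := M.off_diagonal i j hij
  set m := M i j with hm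
  have hm' : (m : ℝ) ≠ 0 := by positivity
  set θ : ℝ := π / m with hθ
  have hmθ : m * θ = π := by rw [hθ]; field_simp
  ext1 z
  have key := Module.reflection_mul_reflection_pow_apply
    (two_smul_form_apply_self M i) (two_smul_form_apply_self M j) m z (2 * cos (2 * θ))
    (by
      simp only [LinearMap.smul_apply, form_simpleRoot, smul_eq_mul, M.symmetric j i, ← hm, ← hθ]
      rw [cos_two_mul]; ring)
  change ((simpleReflection M i * simpleReflection M j) ^ m) z = z
  have hS : ∀ n : ℤ, (Polynomial.Chebyshev.S ℝ n).eval (2 * cos (2 * θ)) * sin (2 * θ)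
      = sin ((n + 1) * (2 * θ)) := fun n => Polynomial.Chebyshev.S_two_mul_real_cos _ n
  rw [simpleReflection, simpleReflection, key]
  -- For m = 2 the factor sin(2θ) is zero and cannot be cancelled below; the two roots are then
  -- orthogonal.
  by_cases h2 : m = 2
  · have hc : cos (2 * θ) = -1 := by
      rw [show 2 * θ = π by rw [← hmθ, h2]; norm_num, cos_pi]
    have hf : form M (simpleRoot i) (simpleRoot j) = 0 := by
      rw [form_simpleRoot, ← hm, h2]; simp
    have hf' : form M (simpleRoot j) (simpleRoot i) = 0 := by rw [form_comm, hf]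
    rw [h2, hc]
    norm_num [hf, hf']
    module
  have hs : sin (2 * θ) ≠ 0 := by
    apply ne_of_gt
    apply sin_pos_of_pos_of_lt_pi
    · have := pi_pos; positivity
    · rw [← hmθ]
      have : (3 : ℝ) ≤ m := by exact_mod_cast (by omega : 3 ≤ m)
      have hp : 0 < θ := by have := pi_pos; positivity
      nlinarith
  -- Each parity leaves one vanishing factor: S_{k-1} if m = 2k, from sin(2kθ) = sin π, and S_k +
  -- S_{k-1} if m = 2k + 1, from sin(π + θ) + sin(π - θ) = 0.
  obtain ⟨k, hk | hk⟩ := Nat.even_or_odd' m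
  · have e1 : ((m : ℤ) - 2) / 2 = k - 1 := by omega
    have e2 : ((m : ℤ) - 1) / 2 = k - 1 := by omega
    have hz : (Polynomial.Chebyshev.S ℝ (k - 1)).eval (2 * cos (2 * θ)) = 0 := by
      have := hS (k - 1)
      rw [show ((((k : ℤ) - 1 : ℤ) : ℝ) + 1) * (2 * θ) = π by
        rw [← hmθ, hk]; push_cast; ring, sin_pi] at this
      exact (mul_eq_zero.mp this).resolve_right hs
    rw [e1, e2, hz]
    simp
  · have e1 : ((m : ℤ) - 2) / 2 = k - 1 := by omega
    have e2 : ((m : ℤ) - 1) / 2 = k := by omega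
    have e3 : ((m : ℤ) - 3) / 2 = k - 1 := by omega
    have e4 : (m : ℤ) / 2 = k := by omega
    have hz : (Polynomial.Chebyshev.S ℝ k).eval (2 * cos (2 * θ)) +
        (Polynomial.Chebyshev.S ℝ (k - 1)).eval (2 * cos (2 * θ)) = 0 := by
      have h3 := hS k
      have h4 := hS (k - 1)
      rw [show ((k : ℤ) + 1 : ℝ) * (2 * θ) = θ + π by
        rw [← hmθ, hk]; push_cast; ring, sin_add_pi] at h3
      rw [show ((((k : ℤ) - 1 : ℤ) : ℝ) + 1) * (2 * θ) = π - θ by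
        rw [← hmθ, hk]; push_cast; ring, sin_pi_sub] at h4
      refine (mul_eq_zero.mp ?_).resolve_right hs
      rw [add_mul, h3, h4]; ring
    rw [e1, e2, e3, e4, hz]
    simp

end GeometricRepresentation

/-! ### Length versus positivity of roots; faithfulness. -/

section Positivity

open Real

variable {B W : Type*} [Group W] {M : CoxeterMatrix B} (cs : CoxeterSystem M W)

/-- The geometric representation of a Coxeter group. -/
noncomputable def geom : W →* ((B →₀ ℝ) ≃ₗ[ℝ] (B →₀ ℝ)) :=
  cs.lift ⟨simpleReflection M, simpleReflection_mul_pow M⟩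

theorem geom_simple (i : B) : geom cs (cs.simple i) = simpleReflection M i :=
  cs.lift_apply_simple (simpleReflection_mul_pow M) i

theorem geom_mul_apply (g h : W) (v : B →₀ ℝ) : geom cs (g * h) v = geom cs g (geom cs h v) := by
  rw [map_mul]; rfl

theorem geom_simple_apply (i : B) (v : B →₀ ℝ) :
    geom cs (cs.simple i) v = v - (2 * form M (simpleRoot i) v) • simpleRoot i := by
  rw [geom_simple, simpleReflection_apply]

theorem geom_simple_simpleRoot (i : B) :
    geom cs (cs.simple i) (simpleRoot i) = -simpleRoot i := by
  rw [geom_simple_apply, form_simpleRoot_self]; module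

theorem form_geom (g : W) (u v : B →₀ ℝ) : form M (geom cs g u) (geom cs g v) = form M u v := by
  induction g using cs.simple_induction_left with
  | one => simp
  | mul_simple_left w i ih => rw [geom_mul_apply, geom_mul_apply, geom_simple,
      form_simpleReflection, ih]

/-- Each further reflection changes one coefficient, by the recursion S_{n+1} = X S_n - S_{n-1}. -/
theorem geom_alternatingWord (i j : B) (n : ℕ) :
    geom cs (cs.wordProd (CoxeterSystem.alternatingWord i j n)) (simpleRoot i) =
      (Polynomial.Chebyshev.S ℝ n).eval (2 * cos (π / M i j)) •
        simpleRoot (if Even n then i else j) +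
      (Polynomial.Chebyshev.S ℝ (n - 1)).eval (2 * cos (π / M i j)) •
        simpleRoot (if Even n then j else i) := by
  induction n with
  | zero => simp [CoxeterSystem.alternatingWord]
  | succ n ih =>
    have hrec : (Polynomial.Chebyshev.S ℝ (n + 1)).eval (2 * cos (π / M i j)) =
        2 * cos (π / M i j) * (Polynomial.Chebyshev.S ℝ n).eval (2 * cos (π / M i j)) -
        (Polynomial.Chebyshev.S ℝ (n - 1)).eval (2 * cos (π / M i j)) := by
      rw [Polynomial.Chebyshev.S_add_one]; simp
    rw [CoxeterSystem.alternatingWord_succ', cs.wordProd_cons, geom_mul_apply, ih]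
    push_cast
    rw [hrec, add_sub_cancel_right]
    by_cases hn : Even n
    · simp only [hn, if_true, Nat.even_add_one, not_true, if_false, map_add, map_smul,
        geom_simple_apply, form_simpleRoot, M.symmetric j i, M.diagonal, Nat.cast_one, div_one, cos_pi]
      module
    · simp only [hn, if_false, Nat.even_add_one, not_false_eq_true, if_true, map_add, map_smul,
        geom_simple_apply, form_simpleRoot, M.diagonal, Nat.cast_one, div_one, cos_pi]
      module

/-- With θ = π/m, S_{n-1}(2 cos θ) sin θ = sin(nθ), and nθ ≤ π. The entry m = 0 encodes infinite
order; division by zero gives the argument 2 there, where S_{n-1} has value n. -/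
theorem eval_S_nonneg (m n : ℕ) (h1 : m ≠ 1) (h : m = 0 ∨ n ≤ m) :
    0 ≤ (Polynomial.Chebyshev.S ℝ (n - 1)).eval (2 * cos (π / m)) := by
  rcases Nat.eq_zero_or_pos m with rfl | hm
  · have : ∀ n : ℕ, (Polynomial.Chebyshev.S ℝ (n - 1)).eval 2 = n ∧
        (Polynomial.Chebyshev.S ℝ n).eval 2 = n + 1 := by
      intro n
      induction n with
      | zero => simp
      | succ n ih =>
        obtain ⟨h1, h2⟩ := ih
        refine ⟨by push_cast; rw [add_sub_cancel_right, h2], ?_⟩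
        push_cast
        rw [Polynomial.Chebyshev.S_add_one]
        simp only [Polynomial.eval_sub, Polynomial.eval_mul, Polynomial.eval_X, h1, h2]
        ring
    simp [(this n).1]
  · have hn : n ≤ m := by omega
    have hS := Polynomial.Chebyshev.S_two_mul_real_cos (π / m) (n - 1)
    have hm0 : (0 : ℝ) < m := by exact_mod_cast hm
    have hpos : 0 < sin (π / m) := by
      apply sin_pos_of_pos_of_lt_pi
      · have := pi_pos; positivity
      · rw [div_lt_iff₀ hm0]
        have : (2 : ℝ) ≤ m := by exact_mod_cast (by omega : 2 ≤ m)
        nlinarith [pi_pos]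
    have hnn : 0 ≤ sin ((((n : ℤ) - 1 : ℤ) + 1 : ℝ) * (π / m)) := by
      have hp := pi_pos
      push_cast
      rw [sub_add_cancel]
      apply sin_nonneg_of_nonneg_of_le_pi
      · positivity
      · rw [← mul_div_assoc, div_le_iff₀ hm0]
        have : (n : ℝ) ≤ m := by exact_mod_cast hn
        nlinarith
    rw [← hS] at hnn
    exact nonneg_of_mul_nonneg_left hnn hpos

theorem simpleRoot_nonneg (i : B) : 0 ≤ simpleRoot i := by
  simp [simpleRoot]

theorem simpleRoot_ne_zero (i : B) : simpleRoot i ≠ 0 := by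
  simp [simpleRoot]

/-- Split w = vd with d the longest possible alternating word in i and a descent j of w, lengths
adding. By induction v keeps both simple roots positive, and d sends the simple root of i to a
nonnegative combination of the two. -/
theorem geom_simpleRoot_nonneg_of_lt (w : W) (i : B)
    (h : cs.length w < cs.length (w * cs.simple i)) :
    0 ≤ geom cs w (simpleRoot i) := by
  induction hn : cs.length w using Nat.strong_induction_on generalizing w i with
  | _ n ih =>
  subst hn
  by_cases hw : w = 1
  · subst hw; simpa using simpleRoot_nonneg i
  obtain ⟨j, hj⟩ := cs.exists_rightDescent_of_ne_one hw
  have hij : i ≠ j := by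
    rintro rfl
    have : cs.length (w * cs.simple i) < cs.length w := hj
    omega
  rw [cs.isRightDescent_iff] at hj
  let P : ℕ → Prop := fun n => ∃ v : W,
    w = v * cs.wordProd (CoxeterSystem.alternatingWord i j n) ∧ cs.length v + n = cs.length w
  have hP1 : P 1 := ⟨w * cs.simple j, by simp [CoxeterSystem.alternatingWord], hj⟩
  obtain ⟨n, ⟨v, hv, hlen⟩, hmax⟩ : ∃ n, P (n + 1) ∧ ¬ P (n + 2) := by
    by_contra! hcon
    have : ∀ n, P (n + 1) := fun n => by
      induction n with
      | zero => exact hP1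
      | succ n ih => exact hcon n ih
    obtain ⟨v, -, hl⟩ := this (cs.length w)
    omega
  have hnext : cs.length v < cs.length (v * cs.simple (if Even (n + 1) then j else i)) := by
    rcases cs.length_mul_simple v (if Even (n + 1) then j else i) with h' | h'
    · omega
    · refine absurd ⟨v * cs.simple (if Even (n + 1) then j else i), ?_, by omega⟩ hmax
      rw [CoxeterSystem.alternatingWord_succ', cs.wordProd_cons, mul_assoc,
        cs.simple_mul_simple_cancel_left, hv]
  have hfirst : cs.length v < cs.length (v * cs.simple (if Even n then j else i)) := by
    rcases cs.length_mul_simple v (if Even n then j else i) with h' | h'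
    · omega
    · rw [CoxeterSystem.alternatingWord_succ', cs.wordProd_cons, ← mul_assoc] at hv
      have h2 := cs.length_mul_le (v * cs.simple (if Even n then j else i))
        (cs.wordProd (CoxeterSystem.alternatingWord i j n))
      have h3 := cs.length_wordProd_le (CoxeterSystem.alternatingWord i j n)
      rw [← hv] at h2
      rw [CoxeterSystem.length_alternatingWord] at h3
      omega
  -- Otherwise the alternating word of length n + 2 for d s_i is not reduced, so w s_i is no longer
  -- than w.
  have hm : M i j = 0 ∨ n + 1 < M i j := by
    by_contra! hcon
    have hred := cs.not_isReduced_alternatingWord j i (m := n + 2)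
      (by rw [M.symmetric]; exact hcon.1) (by rw [M.symmetric]; omega)
    have h3 := cs.length_wordProd_le (CoxeterSystem.alternatingWord j i (n + 2))
    rw [CoxeterSystem.IsReduced] at hred
    rw [CoxeterSystem.length_alternatingWord] at h3 hred
    have h4 : w * cs.simple i =
        v * cs.wordProd (CoxeterSystem.alternatingWord j i (n + 2)) := by
      rw [CoxeterSystem.alternatingWord_succ, cs.wordProd_concat, ← mul_assoc, ← hv]
    have h5 := cs.length_mul_le v (cs.wordProd (CoxeterSystem.alternatingWord j i (n + 2)))
    rw [← h4] at h5
    omega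
  have h1 := M.off_diagonal i j hij
  have hpos : ∀ x, cs.length v < cs.length (v * cs.simple x) → 0 ≤ geom cs v (simpleRoot x) :=
    fun x hx => ih _ (by omega) v x hx rfl
  have hc1 := eval_S_nonneg (M i j) (n + 1) h1 (by omega)
  have hc2 := eval_S_nonneg (M i j) (n + 2) h1 (by omega)
  rw [hv, geom_mul_apply, geom_alternatingWord, map_add, map_smul, map_smul]
  push_cast at hc1 hc2 ⊢
  rw [show (n : ℤ) + 2 - 1 = n + 1 by ring] at hc2
  refine add_nonneg (smul_nonneg hc2 (hpos _ ?_)) (smul_nonneg hc1 (hpos _ ?_))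
  · by_cases he : Even n
    · simpa [he, Nat.even_add_one] using hfirst
    · simpa [he, Nat.even_add_one] using hfirst
  · exact hnext

theorem geom_simpleRoot_nonpos_of_lt (w : W) (i : B)
    (h : cs.length (w * cs.simple i) < cs.length w) : geom cs w (simpleRoot i) ≤ 0 := by
  have := geom_simpleRoot_nonneg_of_lt cs (w * cs.simple i) i (by simpa using h)
  rw [geom_mul_apply, geom_simple_simpleRoot, map_neg] at this
  exact neg_nonneg.mp this

theorem geom_injective : Function.Injective (geom cs) := by
  rw [injective_iff_map_eq_one]
  intro w hw
  by_contra hne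
  obtain ⟨i, hi⟩ := cs.exists_rightDescent_of_ne_one hne
  have := geom_simpleRoot_nonpos_of_lt cs w i hi
  rw [hw] at this
  exact simpleRoot_ne_zero i (le_antisymm this (simpleRoot_nonneg i))

/-- Distinct indices give distinct reflections, so finiteness of W makes the root set finite and the
geometric representation finite-dimensional. -/
theorem finite_index_of_finite {B W : Type*} [Group W] {M : CoxeterMatrix B}
    (cs : CoxeterSystem M W) [Finite W] : Finite B := by
  refine Finite.of_injective cs.simple fun i j hij => ?_
  have h := geom_simple_simpleRoot cs i
  rw [hij, geom_simple_apply] at h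
  by_contra hne
  have := DFunLike.congr_fun h i
  simp [simpleRoot, Ne.symm hne] at this
  norm_num at this

/-- If they commute, s negates wα, so wα is a multiple of α, and invariance of the form forces the
factor ±1. Conversely, wα = ±α gives commuting operators, and the representation is faithful. -/
theorem simple_mul_comm_iff (w : W) (i : B) :
    cs.simple i * w = w * cs.simple i ↔
      geom cs w (simpleRoot i) = simpleRoot i ∨ geom cs w (simpleRoot i) = -simpleRoot i := by
  constructor
  · intro h
    have h1 : geom cs (cs.simple i) (geom cs w (simpleRoot i)) = -geom cs w (simpleRoot i) := by
      rw [← geom_mul_apply, h, geom_mul_apply, geom_simple_simpleRoot, map_neg]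
    rw [geom_simple_apply] at h1
    have h2 : geom cs w (simpleRoot i) =
        (form M (simpleRoot i) (geom cs w (simpleRoot i))) • simpleRoot i := by
      have h3 : (2 : ℝ) • geom cs w (simpleRoot i) =
          (2 : ℝ) • (form M (simpleRoot i) (geom cs w (simpleRoot i))) • simpleRoot i := by
        rw [smul_smul, two_smul]
        nth_rewrite 1 [sub_eq_iff_eq_add.mp h1]
        abel
      exact smul_right_injective _ (two_ne_zero) h3
    have h4 := form_geom cs w (simpleRoot i) (simpleRoot i)
    generalize form M (simpleRoot i) (geom cs w (simpleRoot i)) = c at h2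
    rw [h2] at h4 ⊢
    simp only [map_smul, LinearMap.smul_apply, form_simpleRoot_self, smul_eq_mul, mul_one] at h4
    rcases mul_self_eq_one_iff.mp h4 with rfl | rfl
    · left; simp
    · right; simp
  · intro h
    apply geom_injective cs
    ext1 v
    have hf : ∀ u, form M (simpleRoot i) (geom cs w u) • simpleRoot i =
        form M (simpleRoot i) u • geom cs w (simpleRoot i) := by
      intro u
      have := form_geom cs w (simpleRoot i) u
      rcases h with h | h <;> rw [h] at this ⊢
      · rw [this]
      · rw [← this]; simp
    rw [geom_mul_apply, geom_mul_apply, geom_simple_apply, geom_simple_apply, map_sub, map_smul,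
      mul_smul, mul_smul, hf]

end Positivity

/-! ### Positive and negative roots. -/

section Roots

variable {B W : Type*} [Group W] {M : CoxeterMatrix B} (cs : CoxeterSystem M W)

/-- The roots: the images of the simple roots under the geometric representation. -/
def IsRoot (v : B →₀ ℝ) : Prop := ∃ w i, v = geom cs w (simpleRoot i)

variable {cs}

theorem isRoot_simpleRoot (i : B) : IsRoot cs (simpleRoot i) := ⟨1, i, by simp⟩

theorem IsRoot.geom {v : B →₀ ℝ} (h : IsRoot cs v) (g : W) : IsRoot cs (geom cs g v) := by
  obtain ⟨w, i, rfl⟩ := h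
  exact ⟨g * w, i, (geom_mul_apply cs g w _).symm⟩

theorem IsRoot.neg {v : B →₀ ℝ} (h : IsRoot cs v) : IsRoot cs (-v) := by
  obtain ⟨w, i, rfl⟩ := h
  exact ⟨w * cs.simple i, i, by rw [geom_mul_apply, geom_simple_simpleRoot, map_neg]⟩

theorem IsRoot.ne_zero {v : B →₀ ℝ} (h : IsRoot cs v) : v ≠ 0 := by
  obtain ⟨w, i, rfl⟩ := h
  simpa using simpleRoot_ne_zero i

theorem IsRoot.form_self {v : B →₀ ℝ} (h : IsRoot cs v) : form M v v = 1 := by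
  obtain ⟨w, i, rfl⟩ := h
  rw [form_geom, form_simpleRoot_self]

theorem IsRoot.nonneg_or_nonpos {v : B →₀ ℝ} (h : IsRoot cs v) : 0 ≤ v ∨ v ≤ 0 := by
  obtain ⟨w, i, rfl⟩ := h
  rcases cs.length_mul_simple w i with h | h
  · exact Or.inl (geom_simpleRoot_nonneg_of_lt cs w i (by omega))
  · exact Or.inr (geom_simpleRoot_nonpos_of_lt cs w i (by omega))

theorem IsRoot.neg_nonneg_iff {v : B →₀ ℝ} (h : IsRoot cs v) : 0 ≤ -v ↔ ¬ 0 ≤ v := by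
  constructor
  · intro h1 h2
    exact h.ne_zero (le_antisymm (neg_nonneg.mp h1) h2)
  · intro h1
    exact neg_nonneg.mpr (h.nonneg_or_nonpos.resolve_left h1)

theorem isRightDescent_iff_geom_simpleRoot (w : W) (i : B) :
    cs.IsRightDescent w i ↔ ¬ 0 ≤ geom cs w (simpleRoot i) := by
  constructor
  · intro h
    rw [← ((isRoot_simpleRoot i).geom w).neg_nonneg_iff]
    exact neg_nonneg.mpr (geom_simpleRoot_nonpos_of_lt cs w i h)
  · intro h
    by_contra hd
    rw [cs.not_isRightDescent_iff] at hd
    exact h (geom_simpleRoot_nonneg_of_lt cs w i (by omega))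

/-- The reflection alters only coordinate i. If the image were negative, all other coordinates of v
would vanish, and norm 1 would make v the simple root itself. -/
theorem IsRoot.simple_nonneg {v : B →₀ ℝ} (h : IsRoot cs v) (hv : 0 ≤ v) {i : B}
    (hi : v ≠ simpleRoot i) : 0 ≤ CoxeterInvolution.geom cs (cs.simple i) v := by
  by_contra hneg
  have hle := (h.geom (cs.simple i)).nonneg_or_nonpos.resolve_left hneg
  have hzero : ∀ j, j ≠ i → v j = 0 := by
    intro j hj
    have h1 := hle j
    rw [geom_simple_apply] at h1
    simp [simpleRoot, hj] at h1
    exact le_antisymm h1 (hv j)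
  have hvi : v = v i • simpleRoot i := by
    ext j
    by_cases hj : j = i
    · subst hj; simp [simpleRoot]
    · simp [simpleRoot, hj, hzero j hj]
  have hf := h.form_self
  rw [hvi] at hf
  simp only [map_smul, LinearMap.smul_apply, form_simpleRoot_self, smul_eq_mul, mul_one] at hf
  have hpos : 0 ≤ v i := hv i
  have : v i = 1 := by nlinarith
  rw [this, one_smul] at hvi
  exact hi hvi

variable (cs) in
theorem finite_setOf_isRoot [Finite W] : {v | IsRoot cs v}.Finite := by
  have := finite_index_of_finite cs
  refine (Set.finite_range fun p : W × B => geom cs p.1 (simpleRoot p.2)).subset ?_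
  rintro v ⟨w, i, rfl⟩
  exact ⟨(w, i), rfl⟩

variable (cs) in
/-- The finite set of roots of a finite Coxeter group. -/
noncomputable def roots [Finite W] : Finset (B →₀ ℝ) := (finite_setOf_isRoot cs).toFinset

theorem mem_roots [Finite W] {v : B →₀ ℝ} : v ∈ roots cs ↔ IsRoot cs v := by simp [roots]

end Roots

/-! ### The signed conjugation representation, for parameter 0. -/

section SignRepresentation

variable {B W : Type*} [Group W] {M : CoxeterMatrix B} {cs : CoxeterSystem M W}

open Classical in
/-- The sign of a root. -/
noncomputable def rootSign (v : B →₀ ℝ) : ℚ := if 0 ≤ v then 1 else -1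

open Classical in
/-- The positive root among `v` and `-v`. -/
noncomputable def posRoot (v : B →₀ ℝ) : B →₀ ℝ := if 0 ≤ v then v else -v

theorem posRoot_eq (v : B →₀ ℝ) : posRoot v = v ∨ posRoot v = -v := by
  unfold posRoot; split_ifs <;> simp

theorem posRoot_of_nonneg {v : B →₀ ℝ} (h : 0 ≤ v) : posRoot v = v := by simp [posRoot, h]

theorem IsRoot.posRoot_neg {v : B →₀ ℝ} (h : IsRoot cs v) : posRoot (-v) = posRoot v := by
  have := h.neg_nonneg_iff
  by_cases h0 : 0 ≤ v <;> simp only [posRoot, h0, not_true, not_false_eq_true, iff_false, iff_true,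
    if_true, if_false, neg_neg] at this ⊢
  · rw [if_neg this]
  · rw [if_pos this]

theorem IsRoot.posRoot_nonneg {v : B →₀ ℝ} (h : IsRoot cs v) : 0 ≤ posRoot v := by
  unfold posRoot
  split_ifs with h0
  · exact h0
  · exact h.neg_nonneg_iff.mpr h0

theorem IsRoot.posRoot {v : B →₀ ℝ} (h : IsRoot cs v) : IsRoot cs (posRoot v) := by
  rcases posRoot_eq v with h1 | h1 <;> rw [h1]
  exacts [h, h.neg]

theorem IsRoot.rootSign_neg {v : B →₀ ℝ} (h : IsRoot cs v) : rootSign (-v) = -rootSign v := by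
  have := h.neg_nonneg_iff
  by_cases h0 : 0 ≤ v <;> simp only [rootSign, h0, not_true, not_false_eq_true, iff_false, iff_true,
    if_true, if_false, neg_neg] at this ⊢
  · rw [if_neg this]
  · rw [if_pos this]

theorem IsRoot.rootSign_geom {v : B →₀ ℝ} (h : IsRoot cs v) (g : W) :
    rootSign (CoxeterInvolution.geom cs g v) =
      rootSign (CoxeterInvolution.geom cs g (CoxeterInvolution.posRoot v)) * rootSign v := by
  by_cases h0 : 0 ≤ v
  · have h1 : rootSign v = 1 := if_pos h0
    rw [posRoot_of_nonneg h0, h1, mul_one]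
  · rw [CoxeterInvolution.posRoot, if_neg h0, map_neg, (h.geom g).rootSign_neg]
    simp [rootSign, h0]

theorem IsRoot.posRoot_geom_posRoot_geom {v : B →₀ ℝ} (h : IsRoot cs v) (hv : 0 ≤ v) (g h' : W)
    (hg : g * h' = 1) : CoxeterInvolution.posRoot (CoxeterInvolution.geom cs g
      (CoxeterInvolution.posRoot (CoxeterInvolution.geom cs h' v))) = v := by
  have h1 : CoxeterInvolution.geom cs g (CoxeterInvolution.geom cs h' v) = v := by
    rw [← geom_mul_apply, hg]; simp
  rcases posRoot_eq (CoxeterInvolution.geom cs h' v) with h2 | h2 <;> rw [h2]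
  · rw [h1, posRoot_of_nonneg hv]
  · rw [map_neg, h1, h.posRoot_neg, posRoot_of_nonneg hv]

theorem geom_conj_posRoot {w h : W} {v : B →₀ ℝ} (hv : geom cs w v = -v) :
    geom cs (h * w * h⁻¹) (posRoot (geom cs h v)) = -posRoot (geom cs h v) := by
  have h1 : geom cs (h * w * h⁻¹) (geom cs h v) = -geom cs h v := by
    rw [← geom_mul_apply, inv_mul_cancel_right, geom_mul_apply, hv, map_neg]
  rcases posRoot_eq (geom cs h v) with h2 | h2 <;> rw [h2]
  · exact h1
  · rw [map_neg, h1]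

/-- Conjugation on the elements of square one. -/
def conjInvol (g : W) (w : Invol W) : Invol W :=
  ⟨g * w.1 * g⁻¹, by rw [conj_pow, w.2, mul_one, mul_inv_cancel]⟩

theorem conjInvol_mul (g h : W) (w : Invol W) :
    conjInvol (g * h) w = conjInvol g (conjInvol h w) := by
  apply Subtype.ext
  simp [conjInvol, mul_assoc]

theorem conjSimple_eq (i : B) (w : Invol W) : conjSimple cs i w = conjInvol (cs.simple i) w := by
  apply Subtype.ext
  simp [conjSimple, conjInvol]

variable [Finite W]

open Classical in
variable (cs) in
/-- The positive roots negated by `w`. -/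
noncomputable def negatedRoots (w : W) : Finset (B →₀ ℝ) :=
  {v ∈ roots cs | 0 ≤ v ∧ geom cs w v = -v}

theorem mem_negatedRoots {w : W} {v : B →₀ ℝ} :
    v ∈ negatedRoots cs w ↔ IsRoot cs v ∧ 0 ≤ v ∧ geom cs w v = -v := by
  simp [negatedRoots, mem_roots]

variable (cs) in
/-- The parity of the number of positive roots negated by `w` and made negative by `g`. -/
noncomputable def conjSign (g w : W) : ℚ := ∏ v ∈ negatedRoots cs w, rootSign (geom cs g v)

/-- The map v ↦ ±hv, with the sign making it positive, is a bijection from the positive roots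
negated by w to those negated by hwh⁻¹. After this reindexing the identity holds root by root. -/
theorem conjSign_mul (g h w : W) :
    conjSign cs (g * h) w = conjSign cs g (h * w * h⁻¹) * conjSign cs h w := by
  have h1 : conjSign cs g (h * w * h⁻¹) =
      ∏ v ∈ negatedRoots cs w, rootSign (geom cs g (posRoot (geom cs h v))) := by
    symm
    refine Finset.prod_nbij' (fun v => posRoot (geom cs h v)) (fun v => posRoot (geom cs h⁻¹ v))
      ?_ ?_ ?_ ?_ ?_
    · intro v hv
      rw [mem_negatedRoots] at hv ⊢
      exact ⟨(hv.1.geom h).posRoot, (hv.1.geom h).posRoot_nonneg, geom_conj_posRoot hv.2.2⟩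
    · intro v hv
      rw [mem_negatedRoots] at hv ⊢
      refine ⟨(hv.1.geom _).posRoot, (hv.1.geom _).posRoot_nonneg, ?_⟩
      have := geom_conj_posRoot (h := h⁻¹) hv.2.2
      simpa [mul_assoc] using this
    · intro v hv
      rw [mem_negatedRoots] at hv
      exact hv.1.posRoot_geom_posRoot_geom hv.2.1 _ _ (inv_mul_cancel h)
    · intro v hv
      rw [mem_negatedRoots] at hv
      exact hv.1.posRoot_geom_posRoot_geom hv.2.1 _ _ (mul_inv_cancel h)
    · intro v hv
      rfl
  rw [h1, conjSign, conjSign, ← Finset.prod_mul_distrib]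
  refine Finset.prod_congr rfl fun v hv => ?_
  rw [mem_negatedRoots] at hv
  rw [geom_mul_apply, (hv.1.geom h).rootSign_geom g]

theorem conjSign_one (w : W) : conjSign cs 1 w = 1 := by
  refine Finset.prod_eq_one fun v hv => ?_
  rw [mem_negatedRoots] at hv
  simp [rootSign, hv.2.1]

-- The simple root i is the only positive root made negative by its reflection, so the product has
-- at most one nontrivial factor.
open Classical in
theorem conjSign_simple (i : B) (w : W) : conjSign cs (cs.simple i) w =
    if geom cs w (simpleRoot i) = -simpleRoot i then -1 else 1 := by
  have h1 : conjSign cs (cs.simple i) w =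
      ∏ v ∈ negatedRoots cs w, if v = simpleRoot i then (-1 : ℚ) else 1 := by
    refine Finset.prod_congr rfl fun v hv => ?_
    rw [mem_negatedRoots] at hv
    split_ifs with h
    · rw [h, geom_simple_simpleRoot, (isRoot_simpleRoot (cs := cs) i).rootSign_neg]
      simp [rootSign, simpleRoot_nonneg]
    · simp [rootSign, hv.1.simple_nonneg hv.2.1 h]
  rw [h1, Finset.prod_ite_eq']
  simp [mem_negatedRoots, isRoot_simpleRoot, simpleRoot_nonneg]

variable (cs) in
/-- The representation of `W` by conjugation on its elements of square one, twisted by signs. -/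
noncomputable def signRep : Representation ℚ W (InvolModule W) where
  toFun g := Finsupp.linearCombination ℚ fun w : Invol W =>
    conjSign cs g w.1 • a (conjInvol g w)
  map_one' := by
    ext w : 2
    simp [a, conjSign_one, conjInvol]
  map_mul' g h := by
    ext w : 2
    simp [a, conjInvol_mul]
    simp [conjSign_mul, conjInvol, mul_comm]

open Classical in
theorem signRep_simple (i : B) (w : Invol W) : signRep cs (cs.simple i) (a w) =
    if geom cs w.1 (simpleRoot i) = -simpleRoot i then -a w else a (conjSimple cs i w) := by
  have h1 : signRep cs (cs.simple i) (a w) =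
      conjSign cs (cs.simple i) w.1 • a (conjInvol (cs.simple i) w) := by
    simp [signRep, a]
  rw [h1, conjSign_simple, ← conjSimple_eq]
  split_ifs with h
  · have : conjSimple cs i w = w := Subtype.ext (by
      change cs.simple i * w.1 * cs.simple i = w.1
      rw [(simple_mul_comm_iff cs w.1 i).mpr (Or.inr h), cs.simple_mul_simple_cancel_right])
    rw [this]; simp
  · simp

-- Commutation and descent are both read off from wα, the form in which all later case distinctions
-- are made.
open Classical in
theorem rhoK_apply {B W : Type*} [Group W] {M : CoxeterMatrix B} (cs : CoxeterSystem M W)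
    (k : ℚ) (i : B) (w : Invol W) : rhoK cs k i (a w) =
    if geom cs w.1 (simpleRoot i) = -simpleRoot i then -a w else
    if h : geom cs w.1 (simpleRoot i) = simpleRoot i then
      a w + k • a (mulSimple cs i w ((simple_mul_comm_iff cs w.1 i).mpr (Or.inl h)))
    else a (conjSimple cs i w) := by
  have h1 : rhoK cs k i (a w) = if h : cs.simple i * w.1 = w.1 * cs.simple i then
      if cs.IsRightDescent w.1 i then -a w else a w + k • a (mulSimple cs i w h)
    else a (conjSimple cs i w) := by
    simp [rhoK, a]
  have hroot := isRoot_simpleRoot (cs := cs) i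
  have hc := simple_mul_comm_iff cs w.1 i
  rw [h1]
  by_cases hm : geom cs w.1 (simpleRoot i) = -simpleRoot i
  · rw [dif_pos (hc.mpr (Or.inr hm)), if_pos hm, if_pos]
    rw [isRightDescent_iff_geom_simpleRoot, hm, hroot.neg_nonneg_iff, not_not]
    exact simpleRoot_nonneg i
  by_cases hp : geom cs w.1 (simpleRoot i) = simpleRoot i
  · rw [dif_pos (hc.mpr (Or.inl hp)), if_neg hm, dif_pos hp, if_neg]
    rw [isRightDescent_iff_geom_simpleRoot, hp, not_not]
    exact simpleRoot_nonneg i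
  · rw [dif_neg (fun h => (hc.mp h).elim hp hm), if_neg hm, dif_neg hp]

end SignRepresentation

/-! ### The order by (-1)-eigenspaces and its rank function. -/

section NegationOrder

variable {B W : Type*} [Group W] {M : CoxeterMatrix B} {cs : CoxeterSystem M W}

theorem geom_geom_of_mul_self {w : W} (hw : w * w = 1) (v : B →₀ ℝ) :
    geom cs w (geom cs w v) = v := by
  rw [← geom_mul_apply, hw]; simp

theorem eq_zero_of_eq_neg {v : B →₀ ℝ} (h : v = -v) : v = 0 := self_eq_neg.mp h

variable (cs) in
/-- The order on the elements of square one given by inclusion of their `-1`-eigenspaces. -/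
def NegLE (w z : W) : Prop := w * z = z * w ∧ ∀ v, geom cs w v = -v → geom cs z v = -v

/-- The vector v - wv is negated by w, hence by z; it is also fixed by z, which commutes with w. So
it is zero. -/
theorem NegLE.fixed {w z : W} (h : NegLE cs w z) (hw : w * w = 1) {v : B →₀ ℝ}
    (hv : geom cs z v = v) : geom cs w v = v := by
  have h1 := h.2 (v - geom cs w v) (by rw [map_sub, geom_geom_of_mul_self hw]; abel)
  rw [map_sub, hv, ← geom_mul_apply, ← h.1, geom_mul_apply, hv] at h1
  exact (sub_eq_zero.mp (eq_zero_of_eq_neg h1)).symm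

theorem NegLE.conj {w z : W} (h : NegLE cs w z) (g : W) :
    NegLE cs (g * w * g⁻¹) (g * z * g⁻¹) := by
  refine ⟨?_, fun v hv => ?_⟩
  · have := congrArg (fun x => g * x * g⁻¹) h.1
    simpa [mul_assoc] using this
  · have h1 := h.2 (geom cs g⁻¹ v) (by
      rw [← map_neg, ← hv, ← geom_mul_apply, ← geom_mul_apply]; simp [mul_assoc])
    rw [geom_mul_apply, geom_mul_apply, h1, map_neg, ← geom_mul_apply, mul_inv_cancel]
    simp

theorem negLE_conj_iff {w z : W} (g : W) :
    NegLE cs (g * w * g⁻¹) (g * z * g⁻¹) ↔ NegLE cs w z := by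
  refine ⟨fun h => ?_, fun h => h.conj g⟩
  simpa [mul_assoc] using h.conj g⁻¹

theorem NegLE.antisymm {w z : W} (h : NegLE cs w z) (h' : NegLE cs z w) (hw : w * w = 1)
    (hz : z * z = 1) : w = z := by
  apply geom_injective cs
  ext1 v
  have h1 := h.2 (v - geom cs w v) (by rw [map_sub, geom_geom_of_mul_self hw]; abel)
  have h2 := h'.fixed hz (v := v + geom cs w v)
    (by rw [map_add, geom_geom_of_mul_self hw]; abel)
  rw [map_sub] at h1
  rw [map_add] at h2
  refine smul_right_injective _ (two_ne_zero (α := ℝ)) ?_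
  simp only [two_smul]
  have h3 := congrArg₂ (· + ·) h1 h2
  rw [show geom cs z v - geom cs z (geom cs w v) + (geom cs z v + geom cs z (geom cs w v)) =
    geom cs z v + geom cs z v by abel] at h3
  rw [h3]; abel

theorem form_eq_zero_of_fixed_of_negated {w : W} {u v : B →₀ ℝ} (hu : geom cs w u = u)
    (hv : geom cs w v = -v) : form M u v = 0 := by
  have := form_geom cs w u v
  rw [hu, hv, map_neg] at this
  linarith

theorem geom_simple_of_form_eq_zero {i : B} {v : B →₀ ℝ} (h : form M (simpleRoot i) v = 0) :
    geom cs (cs.simple i) v = v := by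
  rw [geom_simple_apply, h]; simp

/-- Vectors negated by w are orthogonal to the fixed vector α, so s acts trivially on them. -/
theorem NegLE.simple_mul {w z : W} (h : NegLE cs w z) {i : B}
    (hw : geom cs w (simpleRoot i) = simpleRoot i) : NegLE cs w (cs.simple i * z) := by
  have hc := (simple_mul_comm_iff cs w i).mpr (Or.inl hw)
  refine ⟨by rw [← mul_assoc, ← hc, mul_assoc, h.1, mul_assoc], fun v hv => ?_⟩
  rw [geom_mul_apply, h.2 v hv, map_neg,
    geom_simple_of_form_eq_zero (form_eq_zero_of_fixed_of_negated hw hv)]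

theorem negLE_simple_mul_iff {w z : W} {i : B} (hw : geom cs w (simpleRoot i) = simpleRoot i) :
    NegLE cs w (cs.simple i * z) ↔ NegLE cs w z := by
  refine ⟨fun h => ?_, fun h => h.simple_mul hw⟩
  simpa using h.simple_mul hw

variable (cs) in
/-- The `-1`-eigenspace of `w` in the geometric representation. -/
noncomputable def negSpace (w : W) : Submodule ℝ (B →₀ ℝ) :=
  LinearMap.ker ((geom cs w : (B →₀ ℝ) →ₗ[ℝ] (B →₀ ℝ)) + LinearMap.id)

theorem mem_negSpace {w : W} {v : B →₀ ℝ} : v ∈ negSpace cs w ↔ geom cs w v = -v := by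
  simp [negSpace, add_eq_zero_iff_eq_neg]

variable (cs) in
/-- The dimension of the `-1`-eigenspace of `w`. -/
noncomputable def negRank (w : W) : ℕ := Module.finrank ℝ (negSpace cs w)

theorem negRank_conj (g w : W) : negRank cs (g * w * g⁻¹) = negRank cs w := by
  have : negSpace cs (g * w * g⁻¹) =
      (negSpace cs w).map (geom cs g : (B →₀ ℝ) →ₗ[ℝ] (B →₀ ℝ)) := by
    ext v
    rw [Submodule.mem_map, mem_negSpace]
    constructor
    · intro hv
      refine ⟨geom cs g⁻¹ v, ?_, ?_⟩
      · rw [mem_negSpace, ← map_neg, ← hv, ← geom_mul_apply, ← geom_mul_apply]; simp [mul_assoc]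
      · change geom cs g (geom cs g⁻¹ v) = v
        rw [← geom_mul_apply]; simp
    · rintro ⟨u, hu, rfl⟩
      rw [mem_negSpace] at hu
      change geom cs (g * w * g⁻¹) (geom cs g u) = -geom cs g u
      rw [← geom_mul_apply, inv_mul_cancel_right, geom_mul_apply, hu, map_neg]
  rw [negRank, this, LinearEquiv.finrank_map_eq, negRank]

/-- A vector negated by sw becomes one negated by w once its orthogonal projection to the line of α
is removed. This rank jump produces the powers of c. -/
theorem negSpace_simple_mul {w : W} {i : B} (hw : geom cs w (simpleRoot i) = simpleRoot i) :
    negSpace cs (cs.simple i * w) = negSpace cs w ⊔ Submodule.span ℝ {simpleRoot i} := by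
  apply le_antisymm
  · intro v hv
    rw [mem_negSpace, geom_mul_apply] at hv
    have h1 : geom cs w v = -v + (2 * form M (simpleRoot i) v) • simpleRoot i := by
      have := congrArg (geom cs (cs.simple i)) hv
      rw [geom_geom_of_mul_self (cs.simple_mul_simple_self i), map_neg, geom_simple_apply] at this
      rw [this]; abel
    rw [Submodule.mem_sup]
    refine ⟨v - form M (simpleRoot i) v • simpleRoot i, ?_,
      form M (simpleRoot i) v • simpleRoot i,
      Submodule.smul_mem _ _ (Submodule.mem_span_singleton_self _), by abel⟩
    rw [mem_negSpace, map_sub, map_smul, hw, h1]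
    module
  · refine sup_le (fun v hv => ?_) ?_
    · rw [mem_negSpace] at hv ⊢
      rw [geom_mul_apply, hv, map_neg,
        geom_simple_of_form_eq_zero (form_eq_zero_of_fixed_of_negated hw hv)]
    · rw [Submodule.span_singleton_le_iff_mem, mem_negSpace, geom_mul_apply, hw,
        geom_simple_simpleRoot]

theorem NegLE.negSpace_le {w z : W} (h : NegLE cs w z) : negSpace cs w ≤ negSpace cs z :=
  fun v hv => mem_negSpace.mpr (h.2 v (mem_negSpace.mp hv))

theorem neg_simpleRoot_not_nonneg (i : B) : ¬ 0 ≤ -simpleRoot i := fun h =>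
  simpleRoot_ne_zero i (le_antisymm (neg_nonneg.mp h) (simpleRoot_nonneg i))

theorem geom_conj_simple_apply (i : B) (w : W) (v : B →₀ ℝ) :
    geom cs (cs.simple i * w * cs.simple i) (geom cs (cs.simple i) v) =
      geom cs (cs.simple i) (geom cs w v) := by
  rw [← geom_mul_apply, cs.simple_mul_simple_cancel_right, geom_mul_apply]

theorem geom_conj_simple_simpleRoot (i : B) (w : W) :
    geom cs (cs.simple i * w * cs.simple i) (simpleRoot i) =
      -geom cs (cs.simple i) (geom cs w (simpleRoot i)) := by
  rw [← geom_conj_simple_apply, geom_simple_simpleRoot, map_neg, neg_neg]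

theorem geom_conj_simple_eq_iff (i : B) (w : W) :
    geom cs (cs.simple i * w * cs.simple i) (simpleRoot i) = simpleRoot i ↔
      geom cs w (simpleRoot i) = simpleRoot i := by
  rw [geom_conj_simple_simpleRoot, neg_eq_iff_eq_neg, ← geom_simple_simpleRoot cs]
  exact (geom cs (cs.simple i)).injective.eq_iff

theorem geom_conj_simple_eq_neg_iff (i : B) (w : W) :
    geom cs (cs.simple i * w * cs.simple i) (simpleRoot i) = -simpleRoot i ↔
      geom cs w (simpleRoot i) = -simpleRoot i := by
  rw [geom_conj_simple_simpleRoot, neg_inj,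
    ← (geom cs (cs.simple i)).injective.eq_iff (b := -simpleRoot i), map_neg,
    geom_simple_simpleRoot, neg_neg]

theorem conj_simple_mul_self {w : W} (hw : w * w = 1) (i : B) :
    (cs.simple i * w * cs.simple i) * (cs.simple i * w * cs.simple i) = 1 := by
  have := congrArg (fun x => cs.simple i * x * cs.simple i) hw
  simpa [mul_assoc] using this

theorem conj_simple_comm {w z : W} (h : w * z = z * w) (i : B) :
    (cs.simple i * w * cs.simple i) * (cs.simple i * z * cs.simple i) =
      (cs.simple i * z * cs.simple i) * (cs.simple i * w * cs.simple i) := by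
  have := congrArg (fun x => cs.simple i * x * cs.simple i) h
  simpa [mul_assoc] using this

variable [Finite W]

theorem negRank_simple_mul {w : W} {i : B} (hw : geom cs w (simpleRoot i) = simpleRoot i) :
    negRank cs (cs.simple i * w) = negRank cs w + 1 := by
  have := finite_index_of_finite cs
  have h := Submodule.finrank_sup_add_finrank_inf_eq (negSpace cs w)
    (Submodule.span ℝ {simpleRoot i})
  have hbot : negSpace cs w ⊓ Submodule.span ℝ {simpleRoot i} = ⊥ := by
    rw [eq_bot_iff]
    rintro v ⟨h1, h2⟩
    obtain ⟨c, rfl⟩ := Submodule.mem_span_singleton.mp h2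
    have h3 := mem_negSpace.mp h1
    rw [map_smul, hw] at h3
    exact eq_zero_of_eq_neg h3
  rw [hbot, finrank_bot, add_zero, finrank_span_singleton (simpleRoot_ne_zero i),
    ← negSpace_simple_mul hw] at h
  exact h

theorem NegLE.negRank_le {w z : W} (h : NegLE cs w z) : negRank cs w ≤ negRank cs z := by
  have := finite_index_of_finite cs
  exact Submodule.finrank_mono h.negSpace_le

theorem NegLE.eq_of_negRank_le {w z : W} (h : NegLE cs w z) (hw : w * w = 1) (hz : z * z = 1)
    (hr : negRank cs z ≤ negRank cs w) : w = z := by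
  have := finite_index_of_finite cs
  have heq := Submodule.eq_of_le_of_finrank_le h.negSpace_le hr
  exact h.antisymm ⟨h.1.symm, fun v hv => by
    rwa [← mem_negSpace, heq, mem_negSpace]⟩ hw hz

end NegationOrder

/-! ### The sign attached to a pair of commuting involutions. -/

section Signs

variable {B W : Type*} [Group W] {M : CoxeterMatrix B} {cs : CoxeterSystem M W} [Finite W]

open Classical in
variable (cs) in
/-- The positive roots negated by `z`, moved by `w` and kept positive by `w`. -/
noncomputable def keptRoots (z w : W) : Finset (B →₀ ℝ) :=
  {v ∈ roots cs | 0 ≤ v ∧ geom cs z v = -v ∧ 0 ≤ geom cs w v ∧ geom cs w v ≠ v}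

theorem mem_keptRoots {z w : W} {v : B →₀ ℝ} : v ∈ keptRoots cs z w ↔
    IsRoot cs v ∧ 0 ≤ v ∧ geom cs z v = -v ∧ 0 ≤ geom cs w v ∧ geom cs w v ≠ v := by
  simp [keptRoots, mem_roots]

theorem geom_mem_keptRoots_conj {z w : W} {i : B} {v : B →₀ ℝ} (hv : v ∈ keptRoots cs z w)
    (h1 : v ≠ simpleRoot i) (h2 : geom cs w v ≠ simpleRoot i) :
    geom cs (cs.simple i) v ∈
      keptRoots cs (cs.simple i * z * cs.simple i) (cs.simple i * w * cs.simple i) := by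
  rw [mem_keptRoots] at hv ⊢
  obtain ⟨hr, hp, hz, hwp, hw⟩ := hv
  refine ⟨hr.geom _, hr.simple_nonneg hp h1, ?_, ?_, ?_⟩
  · rw [geom_conj_simple_apply, hz, map_neg]
  · rw [geom_conj_simple_apply]
    exact (hr.geom w).simple_nonneg hwp h2
  · rw [geom_conj_simple_apply]
    exact fun h => hw ((geom cs _).injective h)

theorem geom_mem_keptRoots_of_conj {z w : W} {i : B} {v : B →₀ ℝ}
    (hv : v ∈ keptRoots cs (cs.simple i * z * cs.simple i) (cs.simple i * w * cs.simple i))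
    (h1 : v ≠ simpleRoot i)
    (h2 : geom cs (cs.simple i * w * cs.simple i) v ≠ simpleRoot i) :
    geom cs (cs.simple i) v ∈ keptRoots cs z w := by
  simpa [mul_assoc] using geom_mem_keptRoots_conj hv h1 h2

/-- A root `v` in `keptRoots z w` such that `v` or `w v` is simple makes that simple root negated
by `z` and moved off its line by `w`. -/
theorem of_simpleRoot_mem_keptRoots {z w : W} {i : B} {v : B →₀ ℝ} (hw : w * w = 1)
    (hc : w * z = z * w) (hv : v ∈ keptRoots cs z w)
    (h : v = simpleRoot i ∨ geom cs w v = simpleRoot i) :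
    geom cs z (simpleRoot i) = -simpleRoot i ∧ geom cs w (simpleRoot i) ≠ simpleRoot i ∧
      geom cs w (simpleRoot i) ≠ -simpleRoot i := by
  rw [mem_keptRoots] at hv
  obtain ⟨hr, hp, hz, hwp, hne⟩ := hv
  rcases h with h | h
  · rw [h] at hz hwp hne
    exact ⟨hz, hne, fun h => neg_simpleRoot_not_nonneg i (h ▸ hwp)⟩
  · rw [← h, ← geom_mul_apply, ← hc, geom_mul_apply, hz, map_neg, geom_geom_of_mul_self hw]
    refine ⟨rfl, fun h' => hne h'.symm, fun h' => ?_⟩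
    rw [h', h] at hp
    exact neg_simpleRoot_not_nonneg i hp

/-- The reflection s is a bijection of kept roots unless some kept v has v = α or wv = α, which the
hypothesis excludes. -/
theorem card_keptRoots_conj {z w : W} {i : B} (hw : w * w = 1) (hc : w * z = z * w)
    (h : ¬ (geom cs z (simpleRoot i) = -simpleRoot i ∧ geom cs w (simpleRoot i) ≠ simpleRoot i ∧
      geom cs w (simpleRoot i) ≠ -simpleRoot i)) :
    (keptRoots cs (cs.simple i * z * cs.simple i) (cs.simple i * w * cs.simple i)).card =
      (keptRoots cs z w).card := by
  have hss : ∀ v, geom cs (cs.simple i) (geom cs (cs.simple i) v) = v :=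
    geom_geom_of_mul_self (cs.simple_mul_simple_self i)
  refine Finset.card_nbij' (geom cs (cs.simple i)) (geom cs (cs.simple i)) ?_ ?_
    (fun v _ => hss v) (fun v _ => hss v)
  · intro v hv
    have key := fun h' => h (by
      simpa only [ne_eq, geom_conj_simple_eq_neg_iff, geom_conj_simple_eq_iff] using
        of_simpleRoot_mem_keptRoots (i := i) (conj_simple_mul_self hw i) (conj_simple_comm hc i)
          hv h')
    exact geom_mem_keptRoots_of_conj hv (fun h' => key (Or.inl h')) (fun h' => key (Or.inr h'))
  · intro v hv
    have key := fun h' => h (of_simpleRoot_mem_keptRoots (i := i) hw hc hv h')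
    exact geom_mem_keptRoots_conj hv (fun h' => key (Or.inl h')) (fun h' => key (Or.inr h'))

/-- Exactly α and wα are lost under conjugation; s matches all the other kept roots. -/
theorem card_keptRoots_conj_add_two {z w : W} {i : B} (hw : w * w = 1) (hc : w * z = z * w)
    (hz : geom cs z (simpleRoot i) = -simpleRoot i)
    (hne : geom cs w (simpleRoot i) ≠ simpleRoot i) (hpos : 0 ≤ geom cs w (simpleRoot i)) :
    (keptRoots cs (cs.simple i * z * cs.simple i) (cs.simple i * w * cs.simple i)).card + 2 =
      (keptRoots cs z w).card := by
  classical
  have hss : ∀ v, geom cs (cs.simple i) (geom cs (cs.simple i) v) = v :=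
    geom_geom_of_mul_self (cs.simple_mul_simple_self i)
  have hroot := isRoot_simpleRoot (cs := cs) i
  have h1 : simpleRoot i ∈ keptRoots cs z w :=
    mem_keptRoots.mpr ⟨hroot, simpleRoot_nonneg i, hz, hpos, hne⟩
  have h2 : geom cs w (simpleRoot i) ∈ (keptRoots cs z w).erase (simpleRoot i) := by
    refine Finset.mem_erase.mpr ⟨hne, mem_keptRoots.mpr ⟨hroot.geom w, hpos, ?_, ?_, ?_⟩⟩
    · rw [← geom_mul_apply, ← hc, geom_mul_apply, hz, map_neg]
    · rw [geom_geom_of_mul_self hw]; exact simpleRoot_nonneg i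
    · rw [geom_geom_of_mul_self hw]; exact hne.symm
  have hcard : (((keptRoots cs z w).erase (simpleRoot i)).erase
      (geom cs w (simpleRoot i))).card + 2 = (keptRoots cs z w).card := by
    rw [← Finset.card_erase_add_one h1, ← Finset.card_erase_add_one h2]
  have hw' : ¬ 0 ≤ geom cs (cs.simple i * w * cs.simple i) (simpleRoot i) := by
    rw [geom_conj_simple_simpleRoot, ((hroot.geom w).geom _).neg_nonneg_iff, not_not]
    exact (hroot.geom w).simple_nonneg hpos hne
  rw [← hcard, Nat.add_right_cancel_iff]
  refine Finset.card_nbij' (geom cs (cs.simple i)) (geom cs (cs.simple i)) ?_ ?_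
    (fun v _ => hss v) (fun v _ => hss v)
  · intro v hv
    have hv' := mem_keptRoots.mp hv
    have h3 : v ≠ simpleRoot i := by
      rintro rfl
      exact hw' hv'.2.2.2.1
    have h4 : geom cs (cs.simple i * w * cs.simple i) v ≠ simpleRoot i := by
      intro h
      have h5 := geom_geom_of_mul_self (cs := cs) (conj_simple_mul_self (cs := cs) hw i) v
      rw [h] at h5
      rw [h5] at hw'
      exact hw' hv'.2.1
    refine Finset.mem_erase.mpr ⟨fun h => ?_, Finset.mem_erase.mpr ⟨fun h => ?_,
      geom_mem_keptRoots_of_conj hv h3 h4⟩⟩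
    · have h5 := geom_conj_simple_apply (cs := cs) i w (geom cs (cs.simple i) v)
      rw [hss, h, geom_geom_of_mul_self hw, geom_simple_simpleRoot] at h5
      exact neg_simpleRoot_not_nonneg i (h5 ▸ hv'.2.2.2.1)
    · have h5 := hss v
      rw [h, geom_simple_simpleRoot] at h5
      exact neg_simpleRoot_not_nonneg i (h5 ▸ hv'.2.1)
  · intro v hv
    rw [Finset.mem_coe, Finset.mem_erase, Finset.mem_erase] at hv
    refine geom_mem_keptRoots_conj hv.2.2 hv.2.1 fun h => hv.1 ?_
    rw [← h, geom_geom_of_mul_self hw]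

variable (cs) in
/-- The sign `(-1) ^ (n / 2)`, where `n` is the number of positive roots negated by `z`, moved by
`w` and kept positive by `w`. -/
noncomputable def keptSign (z w : W) : ℚ := (-1) ^ ((keptRoots cs z w).card / 2)

theorem keptSign_conj_of_not {z w : W} {i : B} (hw : w * w = 1) (hc : w * z = z * w)
    (h : ¬ (geom cs z (simpleRoot i) = -simpleRoot i ∧ geom cs w (simpleRoot i) ≠ simpleRoot i ∧
      geom cs w (simpleRoot i) ≠ -simpleRoot i)) :
    keptSign cs (cs.simple i * z * cs.simple i) (cs.simple i * w * cs.simple i) =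
      keptSign cs z w := by
  rw [keptSign, card_keptRoots_conj hw hc h, keptSign]

theorem keptSign_conj {z w : W} {i : B} (hw : w * w = 1) (hc : w * z = z * w)
    (hz : geom cs z (simpleRoot i) = -simpleRoot i)
    (hne : geom cs w (simpleRoot i) ≠ simpleRoot i)
    (hne' : geom cs w (simpleRoot i) ≠ -simpleRoot i) :
    keptSign cs (cs.simple i * z * cs.simple i) (cs.simple i * w * cs.simple i) =
      -keptSign cs z w := by
  by_cases hpos : 0 ≤ geom cs w (simpleRoot i)
  · have h := card_keptRoots_conj_add_two hw hc hz hne hpos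
    rw [keptSign, keptSign, ← h, Nat.add_div_right _ (by norm_num), pow_succ]
    ring
  -- If wα is negative, then (sws)α = -s(wα) is positive, so the count applies to the conjugated
  -- pair, and conjugating again returns to (z, w).
  · have hroot := (isRoot_simpleRoot (cs := cs) i).geom w
    have h := card_keptRoots_conj_add_two (cs := cs) (i := i) (conj_simple_mul_self hw i)
      (conj_simple_comm hc i) ((geom_conj_simple_eq_neg_iff i z).mpr hz)
      (fun h => hne ((geom_conj_simple_eq_iff i w).mp h)) (by
        rw [geom_conj_simple_simpleRoot, ← map_neg]
        refine hroot.neg.simple_nonneg (hroot.neg_nonneg_iff.mpr hpos) fun h => hne' ?_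
        rw [neg_eq_iff_eq_neg.mp h])
    simp only [mul_assoc, cs.simple_mul_simple_cancel_left, cs.simple_mul_simple_self,
      mul_one] at h
    simp only [← mul_assoc] at h
    rw [keptSign, keptSign, ← h, Nat.add_div_right _ (by norm_num), pow_succ]
    ring

theorem even_card_of_involution {α : Type*} (s : Finset α) (f : α → α) (hf : ∀ a ∈ s, f a ∈ s)
    (hff : ∀ a ∈ s, f (f a) = a) (hne : ∀ a ∈ s, f a ≠ a) : Even s.card := by
  rw [← ZMod.natCast_eq_zero_iff_even]
  have := Finset.sum_involution (s := s) (f := fun _ => (1 : ZMod 2)) (fun a _ => f a)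
    (fun _ _ => by decide) (fun a ha _ => hne a ha) hf hff
  simpa using this

/-- The kept roots of (sz, w) orthogonal to α are those of (z, w). On the rest, s exchanges positive
and negative pairing with α, and w acts without fixed points preserving the pairing, so their number
is divisible by 4. -/
theorem keptSign_simple_mul {z w : W} {i : B} (hw : w * w = 1) (hc : w * z = z * w)
    (hzi : geom cs z (simpleRoot i) = simpleRoot i)
    (hwi : geom cs w (simpleRoot i) = simpleRoot i) :
    keptSign cs (cs.simple i * z) w = keptSign cs z w := by
  classical
  set s := cs.simple i with hs
  have hss : ∀ v, geom cs s (geom cs s v) = v :=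
    geom_geom_of_mul_self (cs.simple_mul_simple_self i)
  have hsz : s * z = z * s := (simple_mul_comm_iff cs z i).mpr (Or.inl hzi)
  have hsw : s * w = w * s := (simple_mul_comm_iff cs w i).mpr (Or.inl hwi)
  have hform : ∀ v, form M (simpleRoot i) (geom cs s v) = -form M (simpleRoot i) v := by
    intro v
    have := form_geom cs s (simpleRoot i) v
    rw [geom_simple_simpleRoot, map_neg, LinearMap.neg_apply] at this
    rw [← this, neg_neg]
  have hformw : ∀ v, form M (simpleRoot i) (geom cs w v) = form M (simpleRoot i) v := by
    intro v
    have := form_geom cs w (simpleRoot i) v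
    rwa [hwi] at this
  set K := keptRoots cs (s * z) w with hK
  have hzero : K.filter (fun v => form M (simpleRoot i) v = 0) = keptRoots cs z w := by
    ext v
    rw [Finset.mem_filter, mem_keptRoots, mem_keptRoots]
    constructor
    · rintro ⟨⟨h1, h2, h3, h4⟩, h0⟩
      refine ⟨h1, h2, ?_, h4⟩
      rw [hsz, geom_mul_apply, geom_simple_of_form_eq_zero h0] at h3
      exact h3
    · rintro ⟨h1, h2, h3, h4⟩
      have h0 := form_eq_zero_of_fixed_of_negated hzi h3
      refine ⟨⟨h1, h2, ?_, h4⟩, h0⟩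
      rw [hsz, geom_mul_apply, geom_simple_of_form_eq_zero h0, h3]
  have hsK : ∀ v ∈ K, geom cs s v ∈ K := by
    intro v hv
    obtain ⟨h1, h2, h3, h4, h5⟩ := mem_keptRoots.mp hv
    have hne : geom cs w v ≠ simpleRoot i := fun h => h5 (by
      rw [h, ← geom_geom_of_mul_self (cs := cs) hw v, h, hwi])
    have hne' : v ≠ simpleRoot i := fun h => hne (by rw [h, hwi])
    have hsv : geom cs w (geom cs s v) = geom cs s (geom cs w v) := by
      rw [← geom_mul_apply, ← hsw, geom_mul_apply]
    refine mem_keptRoots.mpr ⟨h1.geom _, h1.simple_nonneg h2 hne', ?_, ?_, ?_⟩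
    · rw [geom_mul_apply, ← geom_mul_apply cs z, ← hsz, h3, map_neg]
    · rw [hsv]; exact (h1.geom w).simple_nonneg h4 hne
    · rw [hsv]; exact fun h => h5 ((geom cs s).injective h)
  have hwK : ∀ v ∈ K, geom cs w v ∈ K := by
    intro v hv
    obtain ⟨h1, h2, h3, h4, h5⟩ := mem_keptRoots.mp hv
    refine mem_keptRoots.mpr ⟨h1.geom _, h4, ?_, ?_, ?_⟩
    · rw [← geom_mul_apply, mul_assoc, ← hc, ← mul_assoc, hsw, mul_assoc, geom_mul_apply, h3,
        map_neg]
    · rwa [geom_geom_of_mul_self hw]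
    · rw [geom_geom_of_mul_self hw]; exact h5.symm
  have hswap : (K.filter (fun v => form M (simpleRoot i) v < 0)).card =
      (K.filter (fun v => 0 < form M (simpleRoot i) v)).card := by
    refine Finset.card_nbij' (geom cs s) (geom cs s) ?_ ?_ (fun v _ => hss v) (fun v _ => hss v)
    · intro v hv
      rw [Finset.mem_coe, Finset.mem_filter] at hv ⊢
      exact ⟨hsK v hv.1, by rw [hform]; linarith [hv.2]⟩
    · intro v hv
      rw [Finset.mem_coe, Finset.mem_filter] at hv ⊢
      exact ⟨hsK v hv.1, by rw [hform]; linarith [hv.2]⟩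
  have heven : Even (K.filter (fun v => 0 < form M (simpleRoot i) v)).card := by
    refine even_card_of_involution _ (geom cs w) ?_ (fun v _ => geom_geom_of_mul_self hw v) ?_
    · intro v hv
      rw [Finset.mem_filter] at hv ⊢
      exact ⟨hwK v hv.1, by rw [hformw]; exact hv.2⟩
    · intro v hv
      exact (mem_keptRoots.mp (Finset.mem_filter.mp hv).1).2.2.2.2
  have hsplit : K.card = (keptRoots cs z w).card +
      ((K.filter (fun v => form M (simpleRoot i) v < 0)).card +
      (K.filter (fun v => 0 < form M (simpleRoot i) v)).card) := by
    rw [← hzero, ← Finset.card_filter_add_card_filter_not (fun v => form M (simpleRoot i) v = 0),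
      Nat.add_left_cancel_iff, ← Finset.card_union_of_disjoint, ← Finset.filter_or]
    · simp only [lt_or_lt_iff_ne]
    · rw [Finset.disjoint_filter]
      intro v _ h1 h2
      exact lt_asymm h1 h2
  obtain ⟨e, he⟩ := heven
  rw [hswap, he] at hsplit
  rw [keptSign, keptSign, ← hK, hsplit,
    show (keptRoots cs z w).card + (e + e + (e + e)) = (keptRoots cs z w).card + 2 * (2 * e) by ring,
    Nat.add_mul_div_left _ _ (by norm_num), pow_add, pow_mul]
  simp

end Signs

/-! ### The unitriangular intertwiner. -/

section Intertwiner

variable {B W : Type*} [Group W] {M : CoxeterMatrix B} {cs : CoxeterSystem M W}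

theorem Invol.mul_self (w : Invol W) : w.1 * w.1 = 1 := by rw [← pow_two, w.2]

theorem conjSimple_conjSimple (i : B) (w : Invol W) :
    conjSimple cs i (conjSimple cs i w) = w := by
  apply Subtype.ext
  simp [conjSimple, mul_assoc]

theorem conjSimple_eq_self (i : B) (w : Invol W)
    (h : geom cs w.1 (simpleRoot i) = simpleRoot i ∨
      geom cs w.1 (simpleRoot i) = -simpleRoot i) : conjSimple cs i w = w := by
  apply Subtype.ext
  change cs.simple i * w.1 * cs.simple i = w.1
  rw [(simple_mul_comm_iff cs w.1 i).mpr h, cs.simple_mul_simple_cancel_right]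

theorem geom_simple_mul_eq_iff (i : B) (w : W) :
    geom cs (cs.simple i * w) (simpleRoot i) = simpleRoot i ↔
      geom cs w (simpleRoot i) = -simpleRoot i := by
  rw [geom_mul_apply, ← (geom cs (cs.simple i)).injective.eq_iff (b := -simpleRoot i), map_neg,
    geom_simple_simpleRoot, neg_neg]

theorem geom_simple_mul_eq_neg_iff (i : B) (w : W) :
    geom cs (cs.simple i * w) (simpleRoot i) = -simpleRoot i ↔
      geom cs w (simpleRoot i) = simpleRoot i := by
  rw [geom_mul_apply, ← geom_simple_simpleRoot cs]
  exact (geom cs (cs.simple i)).injective.eq_iff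

theorem simpleRoot_ne_neg (i : B) : simpleRoot i ≠ -simpleRoot i :=
  fun h => simpleRoot_ne_zero i (eq_zero_of_eq_neg h)

open Classical in
theorem a_apply (w y : Invol W) : a w y = if w = y then 1 else 0 := by
  simp [a, Finsupp.single_apply]

-- The transposed description of `rhoK`, suited to the intertwiner, whose values are given by
-- coordinates. Only a y with yα = -α receives two contributions, from y and sy.
open Classical in
theorem rhoK_apply_apply (k : ℚ) (i : B) (x : InvolModule W) (y : Invol W) :
    rhoK cs k i x y =
    if h : geom cs y.1 (simpleRoot i) = -simpleRoot i then
      -x y + k * x (mulSimple cs i y ((simple_mul_comm_iff cs y.1 i).mpr (Or.inr h)))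
    else if geom cs y.1 (simpleRoot i) = simpleRoot i then x y
    else x (conjSimple cs i y) := by
  induction x using Finsupp.induction_linear with
  | zero => simp
  | add x x' hx hx' =>
    rw [map_add, Finsupp.add_apply, hx, hx']
    split_ifs
    · simp only [Finsupp.add_apply]; ring
    · rfl
    · rfl
  | single w c =>
    rw [← mul_one c, ← smul_eq_mul, ← Finsupp.smul_single]
    change rhoK cs k i (c • a w) y = _
    change _ = if h : _ then -(c • a w) y + k * (c • a w) _ else if _ then (c • a w) y else
      (c • a w) _
    rw [map_smul]
    simp only [Finsupp.smul_apply, smul_eq_mul]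
    have hne := simpleRoot_ne_neg i
    rw [rhoK_apply]
    by_cases hw : geom cs w.1 (simpleRoot i) = -simpleRoot i
    · rw [if_pos hw]
      by_cases hy : geom cs y.1 (simpleRoot i) = -simpleRoot i
      · rw [dif_pos hy]
        have h1 : w ≠ mulSimple cs i y ((simple_mul_comm_iff cs y.1 i).mpr (Or.inr hy)) := by
          rintro rfl
          rw [mulSimple, geom_simple_mul_eq_neg_iff, hy] at hw
          exact hne hw.symm
        simp [a_apply, h1]
      · have h1 : w ≠ y := by rintro rfl; exact hy hw
        have h2 : w ≠ conjSimple cs i y := by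
          rintro rfl
          exact hy ((geom_conj_simple_eq_neg_iff i y.1).mp hw)
        rw [dif_neg hy]
        simp [a_apply, h1, h2]
    · rw [if_neg hw]
      by_cases hw' : geom cs w.1 (simpleRoot i) = simpleRoot i
      · rw [dif_pos hw']
        by_cases hy : geom cs y.1 (simpleRoot i) = -simpleRoot i
        · rw [dif_pos hy]
          have h1 : w ≠ y := by rintro rfl; exact hw hy
          have h2 : mulSimple cs i w ((simple_mul_comm_iff cs w.1 i).mpr (Or.inl hw')) = y ↔
              w = mulSimple cs i y ((simple_mul_comm_iff cs y.1 i).mpr (Or.inr hy)) := by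
            rw [Subtype.ext_iff, Subtype.ext_iff]
            simp only [mulSimple]
            constructor
            · intro h; rw [← h]; simp
            · intro h; rw [h]; simp
          simp only [a_apply, h1, h2, Finsupp.add_apply, Finsupp.smul_apply, smul_eq_mul, if_false]
          ring
        · rw [dif_neg hy]
          have h1 : mulSimple cs i w ((simple_mul_comm_iff cs w.1 i).mpr (Or.inl hw')) ≠ y := by
            rintro rfl
            exact hy ((geom_simple_mul_eq_neg_iff i w.1).mpr hw')
          by_cases hy' : geom cs y.1 (simpleRoot i) = simpleRoot i
          · simp [a_apply, h1, hy']
          · have h2 : w ≠ y := by rintro rfl; exact hy' hw'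
            have h3 : w ≠ conjSimple cs i y := by
              rintro rfl
              exact hy' ((geom_conj_simple_eq_iff i y.1).mp hw')
            simp [a_apply, h1, hy', h2, h3]
      · rw [dif_neg hw']
        by_cases hy : geom cs y.1 (simpleRoot i) = -simpleRoot i
        · rw [dif_pos hy]
          have h1 : w ≠ y := by rintro rfl; exact hw hy
          have h2 : w ≠ mulSimple cs i y ((simple_mul_comm_iff cs y.1 i).mpr (Or.inr hy)) := by
            rintro rfl
            exact hw' ((geom_simple_mul_eq_iff i y.1).mpr hy)
          have h3 : conjSimple cs i w ≠ y := by
            rintro rfl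
            exact hw ((geom_conj_simple_eq_neg_iff i w.1).mp hy)
          simp [a_apply, h1, h2, h3]
        · rw [dif_neg hy]
          by_cases hy' : geom cs y.1 (simpleRoot i) = simpleRoot i
          · have h1 : w ≠ y := by rintro rfl; exact hw' hy'
            have h3 : conjSimple cs i w ≠ y := by
              rintro rfl
              exact hw' ((geom_conj_simple_eq_iff i w.1).mp hy')
            simp [a_apply, h1, h3, hy']
          · have h1 : conjSimple cs i w = y ↔ w = conjSimple cs i y := by
              constructor
              · rintro rfl; rw [conjSimple_conjSimple]
              · rintro rfl; rw [conjSimple_conjSimple]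
            simp [a_apply, h1, hy']

theorem negLE_conjSimple_iff (i : B) (w z : Invol W) :
    NegLE cs (conjSimple cs i w).1 (conjSimple cs i z).1 ↔ NegLE cs w.1 z.1 := by
  rw [conjSimple_eq, conjSimple_eq]
  exact negLE_conj_iff _

theorem negRank_conjSimple (i : B) (w : Invol W) :
    negRank cs (conjSimple cs i w).1 = negRank cs w.1 := by
  rw [conjSimple_eq]
  exact negRank_conj _ _

variable [Finite W]

open Classical in
variable (cs) in
/-- The matrix coefficients of the intertwiner. -/
noncomputable def coef (c : ℚ) (w z : Invol W) : ℚ :=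
  if NegLE cs w.1 z.1 then c ^ (negRank cs z.1 - negRank cs w.1) * keptSign cs z.1 w.1 else 0

theorem coef_of_not {c : ℚ} {w z : Invol W} (h : ¬ NegLE cs w.1 z.1) : coef cs c w z = 0 :=
  if_neg h

theorem coef_conj {c : ℚ} {i : B} {w z : Invol W}
    (hz : geom cs z.1 (simpleRoot i) = -simpleRoot i)
    (hne : geom cs w.1 (simpleRoot i) ≠ simpleRoot i)
    (hne' : geom cs w.1 (simpleRoot i) ≠ -simpleRoot i) :
    coef cs c (conjSimple cs i w) (conjSimple cs i z) = -coef cs c w z := by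
  unfold coef
  rw [negLE_conjSimple_iff, negRank_conjSimple, negRank_conjSimple]
  split_ifs with h
  · rw [← mul_neg, ← keptSign_conj w.mul_self h.1 hz hne hne']
    rfl
  · simp

theorem coef_conj_of_not {c : ℚ} {i : B} {w z : Invol W}
    (hn : ¬ (geom cs z.1 (simpleRoot i) = -simpleRoot i ∧
      geom cs w.1 (simpleRoot i) ≠ simpleRoot i ∧ geom cs w.1 (simpleRoot i) ≠ -simpleRoot i)) :
    coef cs c (conjSimple cs i w) (conjSimple cs i z) = coef cs c w z := by
  unfold coef
  rw [negLE_conjSimple_iff, negRank_conjSimple, negRank_conjSimple]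
  split_ifs with h
  · rw [← keptSign_conj_of_not w.mul_self h.1 hn]
    rfl
  · rfl

theorem coef_mulSimple {c : ℚ} {i : B} {w z : Invol W}
    (hz : geom cs z.1 (simpleRoot i) = simpleRoot i)
    (hw : geom cs w.1 (simpleRoot i) = simpleRoot i) :
    coef cs c w (mulSimple cs i z ((simple_mul_comm_iff cs z.1 i).mpr (Or.inl hz))) =
      c * coef cs c w z := by
  by_cases h : NegLE cs w.1 z.1
  · have h' : NegLE cs w.1
        (mulSimple cs i z ((simple_mul_comm_iff cs z.1 i).mpr (Or.inl hz))).1 := h.simple_mul hw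
    rw [coef, coef, if_pos h, if_pos h']
    simp only [mulSimple]
    rw [negRank_simple_mul hz, Nat.sub_add_comm h.negRank_le, pow_succ,
      keptSign_simple_mul w.mul_self h.1 hz hw]
    ring
  · rw [coef_of_not h, coef_of_not fun h' => h ((negLE_simple_mul_iff hw).mp h'), mul_zero]

theorem coef_self (c : ℚ) (w : Invol W) : coef cs c w w = 1 := by
  have h1 : keptRoots cs w.1 w.1 = ∅ := by
    rw [Finset.eq_empty_iff_forall_notMem]
    intro v hv
    obtain ⟨hr, h2, h3, h4, -⟩ := mem_keptRoots.mp hv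
    rw [h3, hr.neg_nonneg_iff] at h4
    exact h4 h2
  have h2 : NegLE cs w.1 w.1 := ⟨rfl, fun _ h => h⟩
  simp [coef, h2, keptSign, h1]

variable (cs) in
/-- The map intertwining the representations with parameters `0` and `2 * c`. -/
noncomputable def intertwiner (c : ℚ) : InvolModule W →ₗ[ℚ] InvolModule W :=
  Finsupp.linearCombination ℚ fun w => Finsupp.equivFunOnFinite.symm (coef cs c w)

theorem intertwiner_a (c : ℚ) (w y : Invol W) : intertwiner cs c (a w) y = coef cs c w y := by
  simp [intertwiner, a]

theorem rhoK_comp_intertwiner (c : ℚ) (i : B) :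
    rhoK cs (2 * c) i ∘ₗ intertwiner cs c = intertwiner cs c ∘ₗ rhoK cs 0 i := by
  ext w y
  simp only [LinearMap.comp_apply, Finsupp.lsingle_apply]
  change rhoK cs (2 * c) i (intertwiner cs c (a w)) y = intertwiner cs c (rhoK cs 0 i (a w)) y
  rw [rhoK_apply_apply, rhoK_apply]
  simp only [zero_smul, add_zero, intertwiner_a, dite_eq_ite]
  have hne := simpleRoot_ne_neg i
  have hcc := conjSimple_conjSimple (cs := cs) i
  by_cases hw : geom cs w.1 (simpleRoot i) = -simpleRoot i
  -- Everything above w negates α.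
  · have hle : ∀ z : Invol W, geom cs z.1 (simpleRoot i) ≠ -simpleRoot i → coef cs c w z = 0 :=
      fun z hz => coef_of_not fun h => hz (h.2 _ hw)
    rw [if_pos hw, map_neg, Finsupp.neg_apply, intertwiner_a]
    split_ifs with h1 h2
    · rw [hle (mulSimple cs i y _), mul_zero, add_zero]
      simp only [mulSimple]
      rw [ne_eq, geom_simple_mul_eq_neg_iff, h1]
      exact hne.symm
    · rw [hle y h1, neg_zero]
    · rw [hle y h1, neg_zero, hle]
      exact fun h => h1 ((geom_conj_simple_eq_neg_iff i y.1).mp h)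
  rw [if_neg hw]
  by_cases hw' : geom cs w.1 (simpleRoot i) = simpleRoot i
  · rw [if_pos hw', intertwiner_a]
    split_ifs with h1 h2
    -- This case fixes the parameter 2c: since coef(w, y) = c · coef(w, sy), the sum -coef(w, y) +
    -- 2c · coef(w, sy) equals coef(w, y).
    · have h2 := coef_mulSimple (c := c) (w := w)
        (z := mulSimple cs i y ((simple_mul_comm_iff cs y.1 i).mpr (Or.inr h1)))
        ((geom_simple_mul_eq_iff i y.1).mpr h1) hw'
      have h3 : mulSimple cs i (mulSimple cs i y ((simple_mul_comm_iff cs y.1 i).mpr (Or.inr h1)))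
          ((simple_mul_comm_iff cs _ i).mpr (Or.inl ((geom_simple_mul_eq_iff i y.1).mpr h1))) =
          y := Subtype.ext (by simp [mulSimple])
      rw [h3] at h2
      rw [h2]; ring
    · rfl
    · rw [← coef_conj_of_not (i := i) (fun h => h.2.1 hw'), hcc, conjSimple_eq_self i w (Or.inl hw')]
  · have hle : ∀ z : Invol W, geom cs z.1 (simpleRoot i) = simpleRoot i → coef cs c w z = 0 :=
      fun z hz => coef_of_not fun h => hw' (h.fixed w.mul_self hz)
    rw [if_neg hw', intertwiner_a]
    split_ifs with h1 h2
    -- The involution sy fixes α while w does not, so its term vanishes; the remaining minus sign is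
    -- absorbed by the sign change of `coef_conj`.
    · rw [hle (mulSimple cs i y _) ((geom_simple_mul_eq_iff i y.1).mpr h1), mul_zero, add_zero,
        ← coef_conj h1 hw' hw, conjSimple_eq_self i y (Or.inr h1)]
    · rw [← coef_conj_of_not (i := i) (fun h => h1 h.1), conjSimple_eq_self i y (Or.inl h2)]
    · rw [← coef_conj_of_not (i := i)
        (fun h => h1 ((geom_conj_simple_eq_neg_iff i y.1).mp h.1)), hcc]

/-- At an element w of minimal rank in the support of x, no other support element lies below w, so
the image has the same nonzero coordinate there as x. -/
theorem intertwiner_injective (c : ℚ) : Function.Injective (intertwiner cs c) := by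
  rw [injective_iff_map_eq_zero]
  intro x hx
  by_contra hne
  obtain ⟨w, hw, hmin⟩ := Finset.exists_min_image x.support (fun w => negRank cs w.1)
    (Finsupp.support_nonempty_iff.mpr hne)
  have h1 : intertwiner cs c x w = x w := by
    rw [intertwiner, Finsupp.linearCombination_apply, Finsupp.sum, Finsupp.finsetSum_apply,
      Finset.sum_eq_single_of_mem w hw]
    · simp [coef_self]
    · intro z hz hzw
      have : coef cs c z w = 0 := coef_of_not fun h => hzw (Subtype.ext
        (h.eq_of_negRank_le z.mul_self w.mul_self (hmin z hz)))
      simp [this]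
  rw [hx] at h1
  exact Finsupp.mem_support_iff.mp hw h1.symm

end Intertwiner

/-! ### Transport to an arbitrary parameter. -/

section Representations

variable {B W : Type*} [Group W] {M : CoxeterMatrix B} {cs : CoxeterSystem M W}

theorem rho_eq_rhoK_zero (cs : CoxeterSystem M W) : rho cs = rhoK cs 0 := by
  classical
  funext i
  ext w : 2
  change rho cs i (a w) = rhoK cs 0 i (a w)
  simp only [rho, rhoK, a, Finsupp.linearCombination_single, one_smul, zero_smul, add_zero]
  by_cases h : cs.simple i * w.1 = w.1 * cs.simple i
  · by_cases hd : cs.IsRightDescent w.1 i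
    · rw [dif_pos h, if_pos hd]
      exact if_pos ⟨h, hd⟩
    · have : conjSimple cs i w = w := Subtype.ext (by simp [conjSimple, h])
      rw [dif_pos h, if_neg hd, this]
      exact if_neg fun h' => hd h'.2
  · rw [if_neg (fun h' => h h'.1), dif_neg h]

theorem signRep_extends [Finite W] : Extends cs (rhoK cs 0) (signRep cs) := by
  intro i
  ext w : 2
  change signRep cs (cs.simple i) (a w) = rhoK cs 0 i (a w)
  rw [signRep_simple, rhoK_apply]
  split_ifs with h1 h2
  · rfl
  · rw [conjSimple_eq_self i w (Or.inl h2)]; simp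
  · rfl

theorem Extends.unique {V : Type*} [AddCommGroup V] [Module ℚ V] {f : B → V →ₗ[ℚ] V}
    {ρ ρ' : Representation ℚ W V} (h : Extends cs f ρ) (h' : Extends cs f ρ') : ρ = ρ' :=
  cs.ext_simple fun i => (h i).trans (h' i).symm

variable (cs) in
/-- For every parameter, the sign representation is equivalent to a representation extending
`rhoK`. -/
theorem exists_extends_equiv_signRep [Finite W] (k : ℚ) :
    ∃ ρ : Representation ℚ W (InvolModule W), Extends cs (rhoK cs k) ρ ∧
      Nonempty ((signRep cs).Equiv ρ) := by
  let e : InvolModule W ≃ₗ[ℚ] InvolModule W :=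
    LinearEquiv.ofInjectiveEndo (intertwiner cs (k / 2)) (intertwiner_injective (k / 2))
  -- Conjugating an existing representation by e makes the relations automatic; only the values on
  -- simple reflections remain to be identified.
  let ρ : Representation ℚ W (InvolModule W) :=
    (e.conjRingEquiv : _ →* _).comp (signRep cs)
  have hρ : ∀ g, e.toLinearMap ∘ₗ signRep cs g = ρ g ∘ₗ e.toLinearMap := by
    intro g
    refine LinearMap.ext fun x => ?_
    change e (signRep cs g x) = e (signRep cs g (e.symm (e x)))
    rw [e.symm_apply_apply]
  refine ⟨ρ, fun i => ?_, ⟨Representation.Equiv.mk e hρ⟩⟩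
  have h1 := rhoK_comp_intertwiner (cs := cs) (k / 2) i
  rw [mul_div_cancel₀ k two_ne_zero, ← signRep_extends i] at h1
  have h2 := (hρ (cs.simple i)).symm.trans h1.symm
  refine LinearMap.ext fun x => ?_
  have h3 := LinearMap.congr_fun h2 (e.symm x)
  have h4 : intertwiner cs (k / 2) (e.symm x) = x := e.apply_symm_apply x
  simpa [h4] using h3

end Representations

end CoxeterInvolution

theorem proposition2p1 {B W : Type*} [Group W] [Finite W] {M : CoxeterMatrix B}
    (cs : CoxeterSystem M W) :
    (∀ k : ℚ, ∃! ρ : Representation ℚ W (CoxeterInvolution.InvolModule W),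
      CoxeterInvolution.Extends cs (CoxeterInvolution.rhoK cs k) ρ) ∧
    (∀ (k k' : ℚ) (ρ ρ' : Representation ℚ W (CoxeterInvolution.InvolModule W)),
      CoxeterInvolution.Extends cs (CoxeterInvolution.rhoK cs k) ρ →
      CoxeterInvolution.Extends cs (CoxeterInvolution.rhoK cs k') ρ' →
      Nonempty (ρ.Equiv ρ')) ∧
    CoxeterInvolution.rho cs = CoxeterInvolution.rhoK cs 0 ∧
    (∃! ρ : Representation ℚ W (CoxeterInvolution.InvolModule W),
      CoxeterInvolution.Extends cs (CoxeterInvolution.rho cs) ρ) := by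
  have hex : ∀ k : ℚ, ∃! ρ : Representation ℚ W (CoxeterInvolution.InvolModule W),
      CoxeterInvolution.Extends cs (CoxeterInvolution.rhoK cs k) ρ := fun k => by
    obtain ⟨ρ, hρ, -⟩ := CoxeterInvolution.exists_extends_equiv_signRep cs k
    exact ⟨ρ, hρ, fun ρ' h => CoxeterInvolution.Extends.unique h hρ⟩
  refine ⟨hex, fun k k' ρ ρ' h h' => ?_, CoxeterInvolution.rho_eq_rhoK_zero cs, ?_⟩
  · obtain ⟨σ, hσ, ⟨e⟩⟩ := CoxeterInvolution.exists_extends_equiv_signRep cs k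
    obtain ⟨σ', hσ', ⟨e'⟩⟩ := CoxeterInvolution.exists_extends_equiv_signRep cs k'
    rw [CoxeterInvolution.Extends.unique h hσ, CoxeterInvolution.Extends.unique h' hσ']
    exact ⟨e.symm.trans e'⟩
  · rw [CoxeterInvolution.rho_eq_rhoK_zero cs]
    exact hex 0
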